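/- Let $n\ge 0$, $d\ge 1$, let $\mathbb P^N=\mathbb P(\mathbb C[x_0,\dots,x_n]_d)$, $N=\binom{n+d}{d}-1$, be the projective space of complex forms of degree $d$ in $n+1$ variables, and let $X=\nu_d(\mathbb P^n)=\{[L^d] : L\neq 0 \text{ a linear form}\}\subset\mathbb P^N$ be the Veronese variety of degree $d$. Let $\tau(X)$ be its tangential variety, that is, the union of its embedded projective tangent spaces. For $f\in\mathbb P^N$, the $X$-rank $\operatorname{rk}_X(f)$ is the least $s$ such that $f$ lies in the linear span of $s$ distinct points of $X$. The linear span of a subscheme $Z\subset\mathbb P^N$, denoted $\langle Z\rangle$, is the intersection of all hyperplanes containing $Z$ as a scheme. Define - the forbidden locus $\mathfrak F(f)\subseteq X$: the set of points of $X$ that are not in the support of any smooth zero-dimensional subscheme $Z\subset X$ of length $\operatorname{rk}_X(f)$ with $f\in\langle Z\rangle$; - the Ranestad--Schreyer locus of length $s$, $\mathfrak{RS}(f)_s\subseteq X$: the set of points $\ell\in X$ for which there is a zero-dimensional subscheme $Z\subset X$ of length $s$ with $f\in\langle Z\rangle$ that is non-reduced at $\ell$. If $f\in\tau(X)\setminus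 X$, then $\mathfrak{RS}(f)_2\subseteq\mathfrak F(f)$. -/

import Mathlib

namespace ProjGeom

/-- The complex projective space with homogeneous coordinates indexed by `σ`. -/
abbrev PSpace (σ : Type) : Type := Projectivization ℂ (σ → ℂ)

/-- The homogeneous ideal of a subset `X` of projective space: the polynomials that vanish on all
coordinate vectors of all points of `X`. -/
noncomputable def homIdeal {σ : Type} (X : Set (PSpace σ)) : Ideal (MvPolynomial σ ℂ) :=
  MvPolynomial.vanishingIdeal ℂ {v : σ → ℂ | ∃ hv : v ≠ 0, Projectivization.mk ℂ v hv ∈ X}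

/-- The closed subschemes of projective space, given by their saturated homogeneous ideals
(this correspondence is a bijection). Saturated means `(I : 𝔪) = I`, with `𝔪` the ideal
generated by the variables. -/
structure Subscheme (σ : Type) where
  ideal : Ideal (MvPolynomial σ ℂ)
  homogeneous : ∀ p ∈ ideal, ∀ k : ℕ, MvPolynomial.homogeneousComponent k p ∈ ideal
  saturated : ∀ p : MvPolynomial σ ℂ, (∀ i : σ, MvPolynomial.X i * p ∈ ideal) → p ∈ ideal

namespace Subscheme

variable {σ : Type}

/-- The value at `k` of the Hilbert function of `Z`: the dimension of the degree `k` part of the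
homogeneous coordinate ring of `Z`. -/
noncomputable def hilbertFunction (Z : Subscheme σ) (k : ℕ) : ℕ :=
  Module.finrank ℂ ((MvPolynomial.homogeneousSubmodule σ ℂ k).map
    (Ideal.Quotient.mkₐ ℂ Z.ideal).toLinearMap)

/-- `Z` is zero-dimensional of length `s` (empty if `s = 0`): its Hilbert polynomial is the
constant `s`. -/
def HasLength (Z : Subscheme σ) (s : ℕ) : Prop :=
  ∀ᶠ k in Filter.atTop, Z.hilbertFunction k = s

/-- `Z` is a subscheme of the (reduced) projective variety `X`. -/
def IsIn (Z : Subscheme σ) (X : Set (PSpace σ)) : Prop :=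
  homIdeal X ≤ Z.ideal

/-- The linear span of `Z`: the common zeros of the linear forms that vanish on the scheme `Z`. -/
def linSpan (Z : Subscheme σ) : Set (PSpace σ) :=
  {f | ∀ p ∈ Z.ideal, p.IsHomogeneous 1 → MvPolynomial.eval f.rep p = 0}

/-- The set of (closed) points of `Z`. -/
def support (Z : Subscheme σ) : Set (PSpace σ) :=
  {x | ∀ p ∈ Z.ideal, MvPolynomial.eval x.rep p = 0}

/-- `Z` is reduced. For zero-dimensional schemes over `ℂ` this is the same as smooth. -/
def IsReduced (Z : Subscheme σ) : Prop :=
  Z.ideal.IsRadical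

/-- The form `g` restricts to zero in the stalk of `Z` at `x`, that is, a multiple `h * g` with
`h` a form not vanishing at `x` lies in the ideal of `Z`. -/
def ZeroAt (Z : Subscheme σ) (x : PSpace σ) (g : MvPolynomial σ ℂ) : Prop :=
  ∃ (h : MvPolynomial σ ℂ) (e : ℕ), h.IsHomogeneous e ∧ MvPolynomial.eval x.rep h ≠ 0 ∧
    h * g ∈ Z.ideal

/-- `x` is a non-reduced point of `Z`: the local ring of `Z` at `x` has a nonzero nilpotent. The
elements of that ring are fractions of forms `g / h` of the same degree with `h` not vanishing at
`x`, and such a fraction is zero (nilpotent) if and only if `g` (some power of `g`) is zero at `x`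
in the sense of `ZeroAt`. Such an `x` is automatically in the support of `Z`. -/
def IsNonReducedAt (Z : Subscheme σ) (x : PSpace σ) : Prop :=
  ∃ (g : MvPolynomial σ ℂ) (e : ℕ), g.IsHomogeneous e ∧ (∃ k : ℕ, Z.ZeroAt x (g ^ k)) ∧
    ¬ Z.ZeroAt x g

end Subscheme

/-- The `X`-rank of `f`: the least number of distinct points of `X` whose linear span
contains `f`. -/
noncomputable def xRank {σ : Type} (X : Set (PSpace σ)) (f : PSpace σ) : ℕ :=
  sInf {s : ℕ | ∃ T : Finset (PSpace σ), (T : Set (PSpace σ)) ⊆ X ∧ T.card = s ∧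
    f.submodule ≤ ⨆ x ∈ T, x.submodule}

/-- The forbidden locus of `f`: the points of `X` that are not in the support of any smooth
zero-dimensional subscheme of `X` of length the `X`-rank of `f` whose span contains `f`. -/
def forbiddenLocus {σ : Type} (X : Set (PSpace σ)) (f : PSpace σ) : Set (PSpace σ) :=
  {x | x ∈ X ∧ ¬ ∃ Z : Subscheme σ, Z.IsIn X ∧ Z.IsReduced ∧ Z.HasLength (xRank X f) ∧
    f ∈ Z.linSpan ∧ x ∈ Z.support}

/-- The Ranestad-Schreyer locus of `f` of length `s`: the points of `X` that are a non-reduced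
point of some zero-dimensional subscheme of `X` of length `s` whose span contains `f`. -/
def ranestadSchreyerLocus {σ : Type} (X : Set (PSpace σ)) (f : PSpace σ) (s : ℕ) :
    Set (PSpace σ) :=
  {x | x ∈ X ∧ ∃ Z : Subscheme σ, Z.IsIn X ∧ Z.HasLength s ∧ f ∈ Z.linSpan ∧ Z.IsNonReducedAt x}

/-- The embedded projective tangent space of `X` at `x`: the zeros of the differentials at `x` of
the polynomials in the ideal of `X`. -/
def tangentSpaceAt {σ : Type} [Fintype σ] (X : Set (PSpace σ)) (x : PSpace σ) :
    Set (PSpace σ) :=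
  {f | ∀ p ∈ homIdeal X, ∑ i, MvPolynomial.eval x.rep (MvPolynomial.pderiv i p) * f.rep i = 0}

/-- The tangential variety of a smooth projective variety `X`: the union of its embedded tangent
spaces (this union is closed, as `X` is smooth and projective). -/
def tangentialVariety {σ : Type} [Fintype σ] (X : Set (PSpace σ)) : Set (PSpace σ) :=
  {f | ∃ x ∈ X, f ∈ tangentSpaceAt X x}

/-- The exponents of the monomials of degree `d` in the `n + 1` variables `x₀, …, xₙ`. A form of
degree `d` is identified with the family of its coefficients, indexed by this type. -/
abbrev Exponents (n d : ℕ) : Type :=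
  {m : Fin (n + 1) →₀ ℕ // m ∈ Finset.finsuppAntidiag Finset.univ d}

/-- The coefficients of the form `(a₀ x₀ + ⋯ + aₙ xₙ) ^ d`. -/
noncomputable def powerVec (n d : ℕ) (a : Fin (n + 1) → ℂ) : Exponents n d → ℂ :=
  fun m => MvPolynomial.coeff m.1 ((∑ i, MvPolynomial.C (a i) * MvPolynomial.X i) ^ d)

theorem powerVec_ne_zero (n d : ℕ) {a : Fin (n + 1) → ℂ} (ha : a ≠ 0) : powerVec n d a ≠ 0 := by
  intro h
  have hL : (∑ i, MvPolynomial.C (a i) * MvPolynomial.X i : MvPolynomial (Fin (n + 1)) ℂ) ≠ 0 := by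
    intro h0
    apply ha
    funext j
    have := congrArg (MvPolynomial.eval (Pi.single j 1)) h0
    simpa [Pi.single_apply] using this
  have hh : ((∑ i, MvPolynomial.C (a i) * MvPolynomial.X i :
      MvPolynomial (Fin (n + 1)) ℂ) ^ d).IsHomogeneous d := by
    have h1 : (∑ i, MvPolynomial.C (a i) * MvPolynomial.X i :
        MvPolynomial (Fin (n + 1)) ℂ).IsHomogeneous 1 :=
      MvPolynomial.IsHomogeneous.sum _ _ _ fun i _ => MvPolynomial.isHomogeneous_C_mul_X _ _
    simpa using h1.pow d
  apply pow_ne_zero d hL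
  ext m
  rw [MvPolynomial.coeff_zero]
  by_contra hm
  have hdeg : m.degree = d := by
    rw [← hh hm, Finsupp.degree_eq_weight_one]
    rfl
  have hmem : m ∈ Finset.finsuppAntidiag (Finset.univ : Finset (Fin (n + 1))) d := by
    rw [Finset.mem_finsuppAntidiag]
    refine ⟨?_, Finset.subset_univ _⟩
    rw [← hdeg, Finsupp.degree_eq_sum]
  exact hm (congrFun h ⟨m, hmem⟩)

/-- The Veronese variety of degree `d` of projective `n`-space: the set of `d`-th powers of
nonzero linear forms in `n + 1` variables, in the projective space of forms of degree `d`. -/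
def veronese (n d : ℕ) : Set (PSpace (Exponents n d)) :=
  {f | ∃ (a : Fin (n + 1) → ℂ) (ha : a ≠ 0),
    f = Projectivization.mk ℂ (powerVec n d a) (powerVec_ne_zero n d ha)}

end ProjGeom

/-! A length-two scheme in the Veronese variety that is non-reduced at `[a ^ d]` is a tangent vector
there, so its span consists of classes of forms `a ^ (d - 1) * b`
(`Subscheme.exists_rep_eq_tangentVec`). Thus `f = a ^ (d - 1) * b`, and `b` is not a multiple of `a`
because `f` is not in the variety.

Suppose `[a ^ d]` also lies on a smooth scheme that computes the rank `r` of `f`. Reducedness gives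
`f = c * a ^ d + w` with `w` in the span of at most `r - 1` other points
(`Subscheme.exists_finset_of_isReduced`). Then `w = a ^ (d - 1) * (b - c * a)`, and the linear
change of variables fixing `a` and sending `b` to `b + c * a` (`exists_transvection`) maps `w` to
`f`. It carries powers of linear forms to such powers, so `f` has rank at most `r - 1`, a
contradiction.

The scheme-theoretic core is `Subscheme.exists_dualNumber_of_isNonReducedAt`, which extracts a
dual-number point from the Hilbert function; the Veronese equations are then solved over the dual
numbers. -/

namespace ProjGeom

open MvPolynomial

/-! ### Coordinates and equations of the Veronese variety -/

/-- The linear form `a₀ x₀ + ⋯ + aₙ xₙ` over a commutative ring. -/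
noncomputable def linForm {n : ℕ} {A : Type} [CommRing A] (a : Fin (n + 1) → A) :
    MvPolynomial (Fin (n + 1)) A :=
  ∑ i, C (a i) * X i

theorem powerVec_eq_coeff (n d : ℕ) (a : Fin (n + 1) → ℂ) (m : Exponents n d) :
    powerVec n d a m = coeff m.1 (linForm a ^ d) := rfl

theorem sum_exponents {n d : ℕ} (m : Exponents n d) : ∑ i, m.1 i = d :=
  (Finset.mem_finsuppAntidiag.1 m.2).1

theorem coeff_linForm_pow {n d : ℕ} {A : Type} [CommRing A] (a : Fin (n + 1) → A)
    (m : Exponents n d) :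
    coeff m.1 (linForm a ^ d) = (m.1.multinomial : A) * ∏ j, a j ^ m.1 j := by
  have h := coeff_linearCombination_X_pow_of_fintype a m.1 d
  have hs : (m.1.sum fun _ k => k) = d := by
    rw [Finsupp.sum_fintype _ _ (fun _ => rfl), sum_exponents]
  have hl : linForm a = ∑ i, a i • (X i : MvPolynomial (Fin (n + 1)) A) := by
    simp [linForm, smul_eq_C_mul]
  rw [hl, h, if_pos hs, Finsupp.prod_fintype _ _ (fun _ => pow_zero _)]

theorem multinomial_ne_zero {n d : ℕ} (m : Exponents n d) : m.1.multinomial ≠ 0 := by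
  rw [Finsupp.multinomial_eq]
  exact (Nat.multinomial_pos _ _).ne'

/-- The exponent of `x_i ^ (d - 1) * x_j`. -/
noncomputable def mixedExp {n d : ℕ} (hd : 1 ≤ d) (i j : Fin (n + 1)) : Exponents n d :=
  ⟨Finsupp.single i (d - 1) + Finsupp.single j 1, by
    rw [Finset.mem_finsuppAntidiag]
    refine ⟨?_, Finset.subset_univ _⟩
    change ∑ k, (Finsupp.single i (d - 1) k + Finsupp.single j 1 k) = d
    simp only [Finset.sum_add_distrib, Finsupp.single_apply, Finset.sum_ite_eq, Finset.mem_univ,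
      if_true]
    omega⟩

theorem prod_pow_mixedExp {n d : ℕ} {A : Type} [CommRing A] (hd : 1 ≤ d) (i j : Fin (n + 1))
    (a : Fin (n + 1) → A) : ∏ k, a k ^ (mixedExp hd i j).1 k = a i ^ (d - 1) * a j := by
  have h (l : Fin (n + 1)) (e : ℕ) : ∏ k, a k ^ Finsupp.single l e k = a l ^ e := by
    rw [Finset.prod_eq_single l (fun k _ hk => by simp [hk]) (by simp), Finsupp.single_eq_same]
  change ∏ k, a k ^ (Finsupp.single i (d - 1) k + Finsupp.single j 1 k) = _
  simp only [pow_add, Finset.prod_mul_distrib, h, pow_one]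

/-- The coordinate at `m`, divided by the multinomial coefficient of `m`. On a power of the linear
form with coefficients `a` its value is `a ^ m`. -/
noncomputable def normCoord {n d : ℕ} (m : Exponents n d) : MvPolynomial (Exponents n d) ℂ :=
  C (m.1.multinomial : ℂ)⁻¹ * X m

theorem isHomogeneous_normCoord {n d : ℕ} (m : Exponents n d) : (normCoord m).IsHomogeneous 1 :=
  isHomogeneous_C_mul_X _ _

theorem eval_normCoord_powerVec {n d : ℕ} (a : Fin (n + 1) → ℂ) (m : Exponents n d) :
    eval (powerVec n d a) (normCoord m) = ∏ j, a j ^ m.1 j := by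
  have h : (m.1.multinomial : ℂ) ≠ 0 := Nat.cast_ne_zero.2 (multinomial_ne_zero m)
  simp [normCoord, powerVec_eq_coeff, coeff_linForm_pow, inv_mul_cancel_left₀ h]

theorem aeval_normCoord {n d : ℕ} {A : Type} [CommRing A] [Algebra ℂ A] (z : Exponents n d → A)
    (m : Exponents n d) : z m = m.1.multinomial * aeval z (normCoord m) := by
  have h : (m.1.multinomial : A) * algebraMap ℂ A (m.1.multinomial : ℂ)⁻¹ = 1 := by
    rw [← map_natCast (algebraMap ℂ A), ← map_mul, 
      mul_inv_cancel₀ (Nat.cast_ne_zero.2 (multinomial_ne_zero m)), map_one]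
  simp only [normCoord, map_mul, aeval_C, aeval_X]
  rw [← mul_assoc, h, one_mul]

/-- An equation of the Veronese variety which computes all coordinates from those at the exponents
of `x_i ^ (d - 1) * x_j`. -/
noncomputable def veroneseEq {n d : ℕ} (hd : 1 ≤ d) (i : Fin (n + 1)) (m : Exponents n d) :
    MvPolynomial (Exponents n d) ℂ :=
  normCoord m * normCoord (mixedExp hd i i) ^ (d - 1) - ∏ j, normCoord (mixedExp hd i j) ^ m.1 j

/-- An equation of the Veronese variety which computes all coordinates, up to roots of unity, from
those at the exponents of pure powers. -/
noncomputable def veronesePowEq {n d : ℕ} (hd : 1 ≤ d) (m : Exponents n d) :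
    MvPolynomial (Exponents n d) ℂ :=
  normCoord m ^ d - ∏ j, normCoord (mixedExp hd j j) ^ m.1 j

theorem isHomogeneous_veroneseEq {n d : ℕ} (hd : 1 ≤ d) (i : Fin (n + 1)) (m : Exponents n d) :
    (veroneseEq hd i m).IsHomogeneous d := by
  refine IsHomogeneous.sub ?_ ?_
  · have := (isHomogeneous_normCoord m).mul ((isHomogeneous_normCoord (mixedExp hd i i)).pow (d - 1))
    rwa [one_mul, Nat.add_sub_cancel' hd] at this
  · have := IsHomogeneous.prod Finset.univ (fun j => normCoord (mixedExp hd i j) ^ m.1 j)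
      (fun j => 1 * m.1 j) (fun j _ => (isHomogeneous_normCoord _).pow _)
    simpa only [one_mul, sum_exponents] using this

theorem powerVec_smul {n d : ℕ} (c : ℂ) (a : Fin (n + 1) → ℂ) :
    powerVec n d (c • a) = c ^ d • powerVec n d a := by
  funext m
  simp only [powerVec_eq_coeff, coeff_linForm_pow, Pi.smul_apply, smul_eq_mul, mul_pow,
    Finset.prod_mul_distrib, Finset.prod_pow_eq_pow_sum, sum_exponents]
  ring

/-- Over `ℂ` the projective scalar has a `d`-th root, which is absorbed into the linear form. -/
theorem exists_eq_powerVec {n d : ℕ} (hd : 1 ≤ d) {v : Exponents n d → ℂ} (hv : v ≠ 0)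
    (h : Projectivization.mk ℂ v hv ∈ veronese n d) :
    ∃ a : Fin (n + 1) → ℂ, a ≠ 0 ∧ v = powerVec n d a := by
  obtain ⟨a, ha, he⟩ := h
  rw [Projectivization.mk_eq_mk_iff'] at he
  obtain ⟨c, rfl⟩ := he
  obtain ⟨b, rfl⟩ := IsAlgClosed.exists_pow_nat_eq c (Nat.pos_of_ne_zero (by omega) : 0 < d)
  have hb : b ≠ 0 := by
    rintro rfl
    simp [zero_pow (by omega : d ≠ 0)] at hv
  exact ⟨b • a, smul_ne_zero hb ha, (powerVec_smul b a).symm⟩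

theorem mem_homIdeal_veronese {n d : ℕ} (hd : 1 ≤ d) {p : MvPolynomial (Exponents n d) ℂ}
    (hp : ∀ a : Fin (n + 1) → ℂ, eval (powerVec n d a) p = 0) : p ∈ homIdeal (veronese n d) := by
  rw [homIdeal, mem_vanishingIdeal_iff]
  rintro v ⟨hv, h⟩
  obtain ⟨a, -, rfl⟩ := exists_eq_powerVec hd hv h
  simpa [aeval_eq_eval] using hp a

theorem veroneseEq_mem {n d : ℕ} (hd : 1 ≤ d) (i : Fin (n + 1)) (m : Exponents n d) :
    veroneseEq hd i m ∈ homIdeal (veronese n d) := by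
  refine mem_homIdeal_veronese hd fun a => ?_
  simp only [veroneseEq, map_sub, map_mul, map_pow, map_prod, eval_normCoord_powerVec,
    prod_pow_mixedExp, mul_pow, Finset.prod_mul_distrib, Finset.prod_pow_eq_pow_sum,
    sum_exponents]
  obtain ⟨k, rfl⟩ := Nat.exists_eq_add_of_le hd
  simp only [Nat.add_sub_cancel_left]
  ring

theorem veronesePowEq_mem {n d : ℕ} (hd : 1 ≤ d) (m : Exponents n d) :
    veronesePowEq hd m ∈ homIdeal (veronese n d) := by
  refine mem_homIdeal_veronese hd fun a => ?_
  simp only [veronesePowEq, map_sub, map_pow, map_prod, eval_normCoord_powerVec,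
    prod_pow_mixedExp, ← pow_succ, Nat.sub_add_cancel hd, ← Finset.prod_pow]
  simp only [← pow_mul, mul_comm d, sub_self]

/-- The multinomial coefficient restores the factor removed by `normCoord`. A general `A` is allowed
because the lemma is applied both to closed points and to dual-number points. -/
theorem mul_pow_eq_coeff_of_veroneseEq {n d : ℕ} (hd : 1 ≤ d) {A : Type} [CommRing A] [Algebra ℂ A]
    (z : Exponents n d → A) (i : Fin (n + 1)) (hz : ∀ m, aeval z (veroneseEq hd i m) = 0)
    (m : Exponents n d) :
    z m * aeval z (normCoord (mixedExp hd i i)) ^ (d - 1) =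
      coeff m.1 (linForm (fun j => aeval z (normCoord (mixedExp hd i j))) ^ d) := by
  have h := hz m
  simp only [veroneseEq, map_sub, map_mul, map_pow, map_prod, sub_eq_zero] at h
  rw [coeff_linForm_pow, ← h, aeval_normCoord z m, mul_assoc]

/-- `veronesePowEq` forces some pure-power coordinate to be nonzero; dividing by its power in
`veroneseEq` then exhibits the point as a `d`-th power. -/
theorem mem_veronese_of_homIdeal {n d : ℕ} (hd : 1 ≤ d) (x : PSpace (Exponents n d))
    (hx : ∀ p ∈ homIdeal (veronese n d), eval x.rep p = 0) : x ∈ veronese n d := by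
  obtain ⟨m, hm⟩ := Function.ne_iff.1 x.rep_nonzero
  have h1 := hx _ (veronesePowEq_mem hd m)
  have hc : eval x.rep (normCoord m) ≠ 0 := by
    simpa [normCoord, multinomial_ne_zero m] using hm
  simp only [veronesePowEq, map_sub, map_pow, map_prod, sub_eq_zero] at h1
  obtain ⟨i, hi⟩ : ∃ i, m.1 i ≠ 0 := by
    by_contra! h
    have := sum_exponents m
    simp [h] at this
    omega
  have ht : eval x.rep (normCoord (mixedExp hd i i)) ≠ 0 := by
    intro h0
    have := Finset.prod_eq_zero (f := fun j => eval x.rep (normCoord (mixedExp hd j j)) ^ m.1 j)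
      (Finset.mem_univ i) (by simp [h0, hi])
    rw [this] at h1
    exact hc (pow_eq_zero_iff (by omega) |>.1 h1)
  have h2 := mul_pow_eq_coeff_of_veroneseEq hd x.rep i (fun m => by
    simpa [aeval_eq_eval] using hx _ (veroneseEq_mem hd i m))
  simp only [aeval_eq_eval] at h2
  refine ⟨fun j => eval x.rep (normCoord (mixedExp hd i j)), fun h => ht (congrFun h i), ?_⟩
  refine x.mk_rep.symm.trans ((Projectivization.mk_eq_mk_iff' ℂ _ _ _ _).2 ?_)
  refine ⟨(eval x.rep (normCoord (mixedExp hd i i)) ^ (d - 1))⁻¹, ?_⟩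
  rw [inv_smul_eq_iff₀ (pow_ne_zero _ ht)]
  funext m
  rw [powerVec_eq_coeff, Pi.smul_apply, smul_eq_mul, mul_comm]
  simpa using (h2 m).symm

/-! ### Algebraic tools -/

theorem aeval_mul_of_isHomogeneous {σ A : Type} [CommRing A] [Algebra ℂ A] {q : MvPolynomial σ ℂ}
    {k : ℕ} (hq : q.IsHomogeneous k) (z : σ → A) (t : A) :
    aeval (fun i => z i * t) q = aeval z q * t ^ k := by
  rw [aeval_def, aeval_def, eval₂_eq, eval₂_eq, Finset.sum_mul]
  refine Finset.sum_congr rfl fun m hm => ?_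
  have h : ∑ i ∈ m.support, m i = k := (hq.degree_eq_sum_deg_support hm).symm
  simp only [mul_pow, Finset.prod_mul_distrib, Finset.prod_pow_eq_pow_sum, h, mul_assoc]

theorem exists_smul_add_smul_of_finrank_eq_two {V : Type} [AddCommGroup V] [Module ℂ V]
    {W : Submodule ℂ V} (hW : Module.finrank ℂ W = 2) {u v q : V} (hu : u ∈ W) (hv : v ∈ W)
    (hq : q ∈ W) (h : ∀ a b : ℂ, a • u + b • v = 0 → a = 0 ∧ b = 0) :
    ∃ a b : ℂ, a • u + b • v = q := by
  have : FiniteDimensional ℂ W := Module.finite_of_finrank_pos (by omega)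
  let w : Fin 2 → W := ![⟨u, hu⟩, ⟨v, hv⟩]
  have hli : LinearIndependent ℂ w := by
    rw [LinearIndependent.pair_iff]
    exact fun a b hab => h a b (by simpa using congrArg Subtype.val hab)
  have hspan := hli.span_eq_top_of_card_eq_finrank' (by rw [Fintype.card_fin, hW])
  have hqW : (⟨q, hq⟩ : W) ∈ Submodule.span ℂ (Set.range w) := by
    rw [hspan]
    trivial
  rw [Matrix.range_cons_cons_empty, Submodule.mem_span_pair] at hqW
  obtain ⟨a, b, hab⟩ := hqW
  exact ⟨a, b, by simpa using congrArg Subtype.val hab⟩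

/-- The localization of the quotient by `I` away from `s`, by its universal features. -/
theorem exists_localization_away {σ : Type} (I : Ideal (MvPolynomial σ ℂ))
    (s : MvPolynomial σ ℂ) :
    ∃ (A : Type) (_ : CommRing A) (_ : Algebra ℂ A) (ψ : MvPolynomial σ ℂ →ₐ[ℂ] A) (t : A),
      ψ s * t = 1 ∧ ∀ q, ψ q = 0 ↔ ∃ N : ℕ, s ^ N * q ∈ I := by
  let A := Localization.Away (Ideal.Quotient.mk I s)
  obtain ⟨t, ht⟩ :=
    (IsLocalization.Away.algebraMap_isUnit (S := A) (Ideal.Quotient.mk I s)).exists_right_inv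
  refine ⟨A, inferInstance, inferInstance,
    (Algebra.algHom ℂ (MvPolynomial σ ℂ ⧸ I) A).comp (Ideal.Quotient.mkₐ ℂ I), t, ht, fun q => ?_⟩
  have := IsLocalization.map_eq_zero_iff (Submonoid.powers (Ideal.Quotient.mk I s)) A
    (Ideal.Quotient.mk I q)
  refine this.trans ⟨?_, ?_⟩
  · rintro ⟨⟨_, N, rfl⟩, h⟩
    exact ⟨N, Ideal.Quotient.eq_zero_iff_mem.1 (by simpa using h)⟩
  · rintro ⟨N, h⟩
    exact ⟨⟨_, N, rfl⟩, by simpa using Ideal.Quotient.eq_zero_iff_mem.2 h⟩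

/-! ### Non-reduced schemes of length two as tangent vectors -/

namespace Subscheme

variable {σ : Type} (Z : Subscheme σ)

theorem mem_of_forall_isHomogeneous_mul_mem (k : ℕ) {p : MvPolynomial σ ℂ}
    (h : ∀ r : MvPolynomial σ ℂ, r.IsHomogeneous k → r * p ∈ Z.ideal) : p ∈ Z.ideal := by
  induction k with
  | zero => simpa using h 1 (isHomogeneous_one σ ℂ)
  | succ k ih =>
    refine ih fun r hr => Z.saturated _ fun i => ?_
    rw [← mul_assoc]
    exact h _ (by simpa [add_comm] using (isHomogeneous_X ℂ i).mul hr)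

theorem exists_isHomogeneous_of_eval_ne_zero {p : MvPolynomial σ ℂ} (hp : p ∈ Z.ideal) {v : σ → ℂ}
    (hv : eval v p ≠ 0) : ∃ q ∈ Z.ideal, ∃ k, q.IsHomogeneous k ∧ eval v q ≠ 0 := by
  by_contra! h
  apply hv
  rw [← sum_homogeneousComponent p, map_sum]
  exact Finset.sum_eq_zero fun k _ => h _ (Z.homogeneous p hp k) k
    (homogeneousComponent_isHomogeneous k p)

theorem mem_support_of_not_zeroAt {x : PSpace σ} {g : MvPolynomial σ ℂ} (hg : ¬ Z.ZeroAt x g) :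
    x ∈ Z.support := by
  intro p hp
  by_contra h
  obtain ⟨q, hq, k, hk, hv⟩ := Z.exists_isHomogeneous_of_eval_ne_zero hp h
  exact hg ⟨q, k, hk, hv, Z.ideal.mul_mem_right g hq⟩

theorem exists_linear_eval_eq_one (x : PSpace σ) :
    ∃ s : MvPolynomial σ ℂ, s.IsHomogeneous 1 ∧ eval x.rep s = 1 := by
  obtain ⟨i, hi⟩ := Function.ne_iff.1 x.rep_nonzero
  exact ⟨C (x.rep i)⁻¹ * X i, isHomogeneous_C_mul_X _ _, by simpa using inv_mul_cancel₀ hi⟩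

variable {Z}

theorem eval_eq_zero_of_zeroAt_pow {x : PSpace σ} {g : MvPolynomial σ ℂ} (hx : x ∈ Z.support)
    {k : ℕ} (hk : Z.ZeroAt x (g ^ k)) : eval x.rep g = 0 := by
  obtain ⟨h, _, -, hv, hm⟩ := hk
  have := hx _ hm
  rw [map_mul, map_pow] at this
  by_contra hg
  exact mul_ne_zero hv (pow_ne_zero k hg) this

/-- A form which does not vanish at `x` and a form which vanishes at `x`, but not on `Z` near `x`,
span the large degree parts of the coordinate ring of a scheme `Z` of length two. -/
theorem exists_sub_mem_of_length_two (hZ : Z.HasLength 2) {x : PSpace σ} {s g : MvPolynomial σ ℂ}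
    {e : ℕ} (hs : s.IsHomogeneous 1) (hs1 : eval x.rep s = 1) (hg : g.IsHomogeneous e)
    (hg0 : eval x.rep g = 0) (hgz : ¬ Z.ZeroAt x g) :
    ∃ K₀, ∀ K ≥ K₀, e ≤ K ∧ ∀ q : MvPolynomial σ ℂ, q.IsHomogeneous K →
      ∃ b : ℂ, q - C (eval x.rep q) * s ^ K - C b * (g * s ^ (K - e)) ∈ Z.ideal := by
  have hx := Z.mem_support_of_not_zeroAt hgz
  obtain ⟨K₀, hK₀⟩ := Filter.eventually_atTop.1 hZ
  refine ⟨max K₀ e, fun K hK => ⟨le_of_max_le_right hK, fun q hq => ?_⟩⟩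
  have heK : e ≤ K := le_of_max_le_right hK
  have hfin := hK₀ K (le_of_max_le_left hK)
  set π := (Ideal.Quotient.mkₐ ℂ Z.ideal).toLinearMap with hπ
  have hπ0 (r) : π r = 0 ↔ r ∈ Z.ideal := Ideal.Quotient.eq_zero_iff_mem
  set W := (homogeneousSubmodule σ ℂ K).map π with hW
  have hsK : s ^ K ∈ homogeneousSubmodule σ ℂ K := by
    simpa using hs.pow K
  have hgK : g * s ^ (K - e) ∈ homogeneousSubmodule σ ℂ K := by
    have := hg.mul (hs.pow (K - e))
    rwa [one_mul, Nat.add_sub_cancel' heK] at this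
  -- The two forms are independent modulo the ideal: evaluation at `x` kills the coefficient of `s ^
  -- K`, and a nonzero coefficient of the other would make `g` zero at `x`.
  obtain ⟨a, b, hab⟩ := exists_smul_add_smul_of_finrank_eq_two (W := W) hfin
    (Submodule.mem_map_of_mem hsK) (Submodule.mem_map_of_mem hgK) (Submodule.mem_map_of_mem hq)
    fun a b hab => by
      rw [← map_smul, ← map_smul, ← map_add, hπ0] at hab
      have ha : a = 0 := by
        simpa [smul_eq_C_mul, hs1, hg0] using hx _ hab
      refine ⟨ha, by_contra fun hb => hgz ⟨C b * s ^ (K - e), _, (hs.pow (K - e)).C_mul b, ?_, ?_⟩⟩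
      · simpa [hs1] using hb
      · rw [ha, zero_smul, zero_add, smul_eq_C_mul] at hab
        convert hab using 1
        ring
  have hab' : π (q - a • s ^ K - b • (g * s ^ (K - e))) = 0 := by
    rw [map_sub, map_sub, map_smul, map_smul, ← hab]
    abel
  rw [hπ0] at hab'
  have ha : eval x.rep q = a := by
    simpa [smul_eq_C_mul, hs1, hg0, sub_eq_zero] using hx _ hab'
  refine ⟨b, ?_⟩
  simpa only [ha, smul_eq_C_mul] using hab'

/-- A scheme of length two which is non-reduced at `x` is given by a tangent vector at `x`. -/
theorem exists_dualNumber_of_isNonReducedAt (hZ : Z.HasLength 2) {x : PSpace σ}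
    (hx : Z.IsNonReducedAt x) :
    ∃ z : σ → DualNumber ℂ, (∀ i, (z i).fst = x.rep i) ∧
      (∀ k, ∀ q ∈ Z.ideal, q.IsHomogeneous k → aeval z q = 0) ∧
      ∀ p : MvPolynomial σ ℂ, p.IsHomogeneous 1 → aeval z p = 0 → p ∈ Z.ideal := by
  obtain ⟨g, e, hg, ⟨k, hk⟩, hgz⟩ := hx
  have hxs := Z.mem_support_of_not_zeroAt hgz
  have hg0 := eval_eq_zero_of_zeroAt_pow hxs hk
  obtain ⟨s, hs, hs1⟩ := exists_linear_eval_eq_one x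
  obtain ⟨K₀, hK₀⟩ := exists_sub_mem_of_length_two hZ hs hs1 hg hg0 hgz
  have hsN (N : ℕ) : (s ^ N).IsHomogeneous N := by simpa using hs.pow N
  have hgz' {N : ℕ} {b : ℂ} (h : s ^ N * (C b * g) ∈ Z.ideal) : b = 0 := by
    by_contra hb
    exact hgz ⟨C b * s ^ N, N, (hsN N).C_mul b, by simpa [hs1] using hb, by convert h using 1; ring⟩
  -- Work on the affine chart `s ≠ 0`; there `γ` is the function `g / s ^ e`, and the coordinate
  -- ring is spanned by `1` and `γ`.
  obtain ⟨A, _, _, ψ, t, ht, hψ⟩ := exists_localization_away Z.ideal s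
  have htN (N : ℕ) : ψ s ^ N * t ^ N = 1 := by rw [← mul_pow, ht, one_pow]
  have hψt {q : MvPolynomial σ ℂ} {N : ℕ} (h : ψ q * t ^ N = 0) : ψ q = 0 := by
    have := congrArg (· * ψ s ^ N) h
    simpa [mul_assoc, mul_comm (t ^ N), htN] using this
  set γ := ψ g * t ^ e with hγ
  have hexp (j : ℕ) (q : MvPolynomial σ ℂ) (hq : q.IsHomogeneous j) :
      ∃ b : ℂ, ψ q * t ^ j = algebraMap ℂ A (eval x.rep q) + algebraMap ℂ A b * γ := by
    -- Multiplying by `s ^ K₀` brings `q` into the range where the Hilbert function is two; `s` is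
    -- invertible in `A`.
    obtain ⟨heK, hK⟩ := hK₀ (K₀ + j) (by omega)
    obtain ⟨b, hb⟩ := hK (s ^ K₀ * q) ((hsN K₀).mul hq)
    refine ⟨b, ?_⟩
    have h0 := (hψ _).2 ⟨0, by simpa using hb⟩
    have hC (c : ℂ) : ψ (C c) = algebraMap ℂ A c := ψ.commutes c
    simp only [map_sub, map_mul, map_pow, hs1, one_pow, map_one, one_mul, hC] at h0
    have h1 := congrArg (· * t ^ (K₀ + j)) h0
    have h2 := htN (K₀ + j)
    have h3 : ψ s ^ (K₀ + j - e) * t ^ (K₀ + j) = t ^ e := by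
      obtain ⟨r, hr⟩ := Nat.exists_eq_add_of_le heK
      rw [hr, Nat.add_sub_cancel_left, pow_add, mul_left_comm, htN, mul_one]
    have h4 : ψ s ^ K₀ * t ^ (K₀ + j) = t ^ j := by
      rw [pow_add, ← mul_assoc, htN, one_mul]
    simp only [zero_mul] at h1
    rw [hγ]
    linear_combination h1 + algebraMap ℂ A (eval x.rep q) * h2 + algebraMap ℂ A b * ψ g * h3 -
      ψ q * h4
  obtain ⟨b, hb⟩ := hexp (e + e) (g * g) (hg.mul hg)
  have hγ2 : γ * γ = algebraMap ℂ A b * γ := by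
    rw [map_mul, map_mul (eval _), hg0, zero_mul, map_zero, zero_add] at hb
    rw [← hb, hγ]
    ring
  -- If `b ≠ 0`, the powers of `γ` are nonzero multiples of `γ`, so the form `h` that kills `g ^ k`
  -- also kills `γ`, and `g` is zero at `x`.
  have hb0 : b = 0 := by
    by_contra hb0
    obtain ⟨h, j, hh, hv, hm⟩ := hk
    have hpow : γ ^ (k + 1) = algebraMap ℂ A b ^ k * γ := by
      clear hm
      induction k with
      | zero => simp
      | succ k ih => rw [pow_succ, ih, mul_assoc, hγ2]; ring
    have hm0 : ψ h * ψ g ^ k = 0 := by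
      rw [← map_pow, ← map_mul]
      exact (hψ _).2 ⟨0, by simpa using hm⟩
    have hz : ψ h * γ = 0 := by
      have hu : algebraMap ℂ A (b⁻¹) * algebraMap ℂ A b = 1 := by
        rw [← map_mul, inv_mul_cancel₀ hb0, map_one]
      have h1 : ψ h * γ ^ (k + 1) = 0 := by
        rw [hγ, mul_pow, pow_succ]
        linear_combination ψ g * (t ^ e) ^ (k + 1) * hm0
      rw [hpow] at h1
      calc ψ h * γ = (algebraMap ℂ A (b⁻¹) * algebraMap ℂ A b) ^ k * (ψ h * γ) := by
            rw [hu, one_pow, one_mul]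
        _ = algebraMap ℂ A (b⁻¹) ^ k * (ψ h * (algebraMap ℂ A b ^ k * γ)) := by ring
        _ = 0 := by rw [h1, mul_zero]
    have hz' : ψ (h * g) = 0 := hψt (N := e) (by rw [map_mul, mul_assoc]; exact hz)
    obtain ⟨N, hN⟩ := (hψ _).1 hz'
    exact hgz ⟨s ^ N * h, N + j, (hsN N).mul hh, by simpa [hs1] using hv, by rwa [mul_assoc]⟩
  have hγγ : γ * γ = 0 := by rw [hγ2, hb0, map_zero, zero_mul]
  -- Since `γ` squares to zero, `ε ↦ γ` embeds the dual numbers in `A`; the coordinates divided by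
  -- `s` lie in the image, and `z` is their preimage.
  let φ : DualNumber ℂ →ₐ[ℂ] A :=
    DualNumber.lift ⟨(Algebra.ofId ℂ A, γ), hγγ, fun _ => mul_comm _ _⟩
  have hφ (w : DualNumber ℂ) : φ w = algebraMap ℂ A w.fst + algebraMap ℂ A w.snd * γ := rfl
  have hφinj (w : DualNumber ℂ) (hw : φ w = 0) : w = 0 := by
    rw [hφ, hγ] at hw
    have h1 : ψ (C w.fst * s ^ e + C w.snd * g) = 0 := by
      refine hψt (N := e) ?_
      have hC (c : ℂ) : ψ (C c) = algebraMap ℂ A c := ψ.commutes c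
      simp only [map_add, map_mul, map_pow, hC]
      linear_combination hw + algebraMap ℂ A w.fst * htN e
    obtain ⟨N, hN⟩ := (hψ _).1 h1
    have ha : w.fst = 0 := by simpa [hs1, hg0] using hxs _ hN
    rw [ha, C_0, zero_mul, zero_add] at hN
    exact TrivSqZeroExt.ext ha (hgz' hN)
  choose v hv using fun i => hexp 1 (X i) (isHomogeneous_X ℂ i)
  let z : σ → DualNumber ℂ := fun i => TrivSqZeroExt.inl (x.rep i) + TrivSqZeroExt.inr (v i)
  have hφz (j : ℕ) (q : MvPolynomial σ ℂ) (hq : q.IsHomogeneous j) :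
      φ (aeval z q) = ψ q * t ^ j := by
    have h1 : (fun i => φ (z i)) = fun i => ψ (X i) * t := by
      funext i
      rw [hφ]
      simpa [z] using (hv i).symm
    rw [← AlgHom.comp_apply, comp_aeval]
    change aeval (fun i => φ (z i)) q = _
    rw [h1, aeval_mul_of_isHomogeneous hq]
    congr 1
    exact (DFunLike.congr_fun (aeval_unique ψ) q).symm
  refine ⟨z, fun i => by simp [z], fun j q hqI hq => hφinj _ ?_, fun p hp hpz => ?_⟩
  · rw [hφz j q hq, (hψ q).2 ⟨0, by simpa using hqI⟩, zero_mul]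
  · obtain ⟨N, hN⟩ := (hψ p).1 (hψt (N := 1) (by rw [← hφz 1 p hp, hpz, map_zero]))
    have hp0 : eval x.rep p = 0 := by simpa [hs1] using hxs _ hN
    obtain ⟨heK, hK⟩ := hK₀ (K₀ + 1) (by omega)
    -- Vanishing on the chart gives only `s ^ N * p` in the ideal. Saturation reduces the claim to
    -- multiples `r * p` of large degree, where the two-term expansion has both coefficients zero.
    refine Z.mem_of_forall_isHomogeneous_mul_mem K₀ fun r hr => ?_
    obtain ⟨b, hb⟩ := hK (r * p) (hr.mul hp)
    rw [map_mul, hp0, mul_zero, C_0, zero_mul, sub_zero] at hb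
    have hb0 : b = 0 := by
      refine hgz' (N := N + (K₀ + 1 - e)) ?_
      have := Z.ideal.sub_mem (Z.ideal.mul_mem_left r hN) (Z.ideal.mul_mem_left (s ^ N) hb)
      convert this using 1
      ring
    simpa [hb0] using hb

end Subscheme

/-! ### Linear spans and reduced schemes -/

theorem submodule_le_iff {σ : Type} (f : PSpace σ) (W : Submodule ℂ (σ → ℂ)) :
    f.submodule ≤ W ↔ f.rep ∈ W := by
  rw [f.submodule_eq, Submodule.span_singleton_le_iff_mem]

/-- The linear form with given values at the coordinate vectors. -/
theorem exists_linear_eval {σ : Type} [Fintype σ] (θ : (σ → ℂ) →ₗ[ℂ] ℂ) :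
    ∃ p : MvPolynomial σ ℂ, p.IsHomogeneous 1 ∧ ∀ v, eval v p = θ v := by
  classical
  refine ⟨∑ i, C (θ (Pi.single i 1)) * X i,
    IsHomogeneous.sum _ _ _ fun i _ => isHomogeneous_C_mul_X _ _, fun v => ?_⟩
  conv_rhs => rw [pi_eq_sum_univ' v]
  simp [mul_comm]

theorem mem_span_of_forall_linear {σ : Type} [Fintype σ] {S : Set (σ → ℂ)} {f : σ → ℂ}
    (h : ∀ p : MvPolynomial σ ℂ, p.IsHomogeneous 1 → (∀ v ∈ S, eval v p = 0) → eval f p = 0) :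
    f ∈ Submodule.span ℂ S := by
  by_contra hf
  obtain ⟨θ, hθ, hle⟩ := Submodule.exists_le_ker_of_notMem hf
  obtain ⟨p, hp, he⟩ := exists_linear_eval θ
  refine hθ ?_
  rw [← he]
  exact h p hp fun v hv => (he v).trans (hle (Submodule.subset_span hv))

theorem exists_linear_eval_ne_zero {σ : Type} [Fintype σ] {x y : PSpace σ} (h : x ≠ y) :
    ∃ p : MvPolynomial σ ℂ, p.IsHomogeneous 1 ∧ eval y.rep p = 0 ∧ eval x.rep p ≠ 0 := by
  by_contra! hp
  have hm := mem_span_of_forall_linear (S := {y.rep}) (f := x.rep) fun p h1 h2 =>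
    hp p h1 (h2 _ rfl)
  obtain ⟨c, hc⟩ := Submodule.mem_span_singleton.1 hm
  apply h
  rw [← x.mk_rep, ← y.mk_rep, Projectivization.mk_eq_mk_iff']
  exact ⟨c, hc⟩

theorem eval_smul_of_isHomogeneous {σ : Type} {q : MvPolynomial σ ℂ} {k : ℕ}
    (hq : q.IsHomogeneous k) (c : ℂ) (v : σ → ℂ) : eval (c • v) q = c ^ k * eval v q := by
  have := aeval_mul_of_isHomogeneous hq v c
  rw [aeval_eq_eval, aeval_eq_eval] at this
  rw [mul_comm, ← this]
  congr 2
  funext i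
  exact mul_comm _ _

namespace Subscheme

variable {σ : Type} [Fintype σ] {Z : Subscheme σ} {s : ℕ}

/-- Distinct points impose independent conditions on forms of large degree: products of linear forms
separate them. The factor `l ^ K₀` pads the degree into the range where the Hilbert function is `s`.
-/
theorem card_le_of_hasLength (hZ : Z.HasLength s) (T : Finset (PSpace σ))
    (hT : ↑T ⊆ Z.support) : T.card ≤ s := by
  classical
  obtain ⟨K₀, hK₀⟩ := Filter.eventually_atTop.1 hZ
  have hsep (x : PSpace σ) : ∃ p : MvPolynomial σ ℂ, p.IsHomogeneous (K₀ + T.card) ∧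
      eval x.rep p ≠ 0 ∧ ∀ y ∈ T, y ≠ x → eval y.rep p = 0 := by
    obtain ⟨l, hl, hl1⟩ := exists_linear_eval_eq_one x
    have hl0 : eval x.rep l ≠ 0 := by simp [hl1]
    have h (y : PSpace σ) : ∃ p : MvPolynomial σ ℂ, p.IsHomogeneous 1 ∧ eval x.rep p ≠ 0 ∧
        (y ≠ x → eval y.rep p = 0) := by
      by_cases hyx : y = x
      · exact ⟨l, hl, hl0, fun h => absurd hyx h⟩
      · obtain ⟨p, hp, h0, h1⟩ := exists_linear_eval_ne_zero (Ne.symm hyx)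
        exact ⟨p, hp, h1, fun _ => h0⟩
    choose p hp hp1 hp0 using h
    refine ⟨l ^ K₀ * ∏ y ∈ T, p y, ?_, ?_, fun y hy hyx => ?_⟩
    · have := (hl.pow K₀).mul (IsHomogeneous.prod T p (fun _ => 1) fun y _ => hp y)
      simpa using this
    · rw [map_mul, map_pow, map_prod]
      exact mul_ne_zero (pow_ne_zero _ hl0) (Finset.prod_ne_zero_iff.2 fun y _ => hp1 y)
    · rw [map_mul, map_prod, Finset.prod_eq_zero hy (hp0 y hyx), mul_zero]
  choose p hp hp1 hp0 using hsep
  set π := (Ideal.Quotient.mkₐ ℂ Z.ideal).toLinearMap with hπ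
  set W := (homogeneousSubmodule σ ℂ (K₀ + T.card)).map π with hW
  let w : T → W := fun x => ⟨π (p x), Submodule.mem_map_of_mem (hp x)⟩
  have hli : LinearIndependent ℂ w := by
    rw [Fintype.linearIndependent_iff]
    intro c hc x
    have h1 : π (∑ y, c y • p y) = 0 := by
      have := congrArg Subtype.val hc
      simpa [w] using this
    have h2 : eval x.1.rep (∑ y, c y • p y) = 0 :=
      hT x.2 _ (Ideal.Quotient.eq_zero_iff_mem.1 h1)
    rw [map_sum, Finset.sum_eq_single x, smul_eval] at h2
    · exact (mul_eq_zero.1 h2).resolve_right (hp1 x)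
    · intro y _ hyx
      rw [smul_eval, hp0 y x x.2 (fun h => hyx (Subtype.ext h.symm)), mul_zero]
    · simp
  have : FiniteDimensional ℂ W := by
    have := homogeneousSubmodule_fg σ ℂ (K₀ + T.card)
    exact Module.Finite.iff_fg.2 (this.map π)
  have h := hli.fintype_card_le_finrank
  rw [Fintype.card_coe] at h
  exact h.trans_eq (hK₀ _ (by omega))

/-- The span of a reduced scheme is the span of its points. -/
theorem rep_mem_span_of_isReduced (hZ : Z.IsReduced) {f : PSpace σ} (hf : f ∈ Z.linSpan) :
    f.rep ∈ Submodule.span ℂ (Projectivization.rep '' Z.support) := by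
  refine mem_span_of_forall_linear fun p hp hv => hf p ?_ hp
  -- By the Nullstellensatz, a linear form vanishing at all points of a reduced scheme lies in its
  -- ideal. The zero locus is an affine cone, so the origin is treated separately.
  rw [← hZ.radical, ← vanishingIdeal_zeroLocus_eq_radical (K := ℂ), mem_vanishingIdeal_iff]
  intro u hu
  rw [mem_zeroLocus_iff] at hu
  simp only [aeval_eq_eval] at hu ⊢
  by_cases hu0 : u = 0
  · subst hu0
    simpa using eval_smul_of_isHomogeneous hp 0 (0 : σ → ℂ)
  obtain ⟨c, hc⟩ := Projectivization.exists_smul_eq_mk_rep ℂ u hu0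
  have hmem : Projectivization.mk ℂ u hu0 ∈ Z.support := by
    intro q hq
    by_contra h
    obtain ⟨r, hr, k, hk, hne⟩ := Z.exists_isHomogeneous_of_eval_ne_zero hq h
    apply hne
    rw [← hc]
    change eval ((c : ℂ) • u) r = 0
    rw [eval_smul_of_isHomogeneous hk]
    have h0 : eval u r = 0 := hu r hr
    rw [h0, mul_zero]
  have h0 := hv _ ⟨_, hmem, rfl⟩
  rw [← hc] at h0
  change eval ((c : ℂ) • u) p = 0 at h0
  rw [eval_smul_of_isHomogeneous hp] at h0
  exact (mul_eq_zero.1 h0).resolve_left (pow_ne_zero _ c.ne_zero)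

end Subscheme

/-- A reduced scheme of length `s` in the Veronese variety is a finite set of points of it. -/
theorem Subscheme.exists_finset_of_isReduced {n d s : ℕ} (hd : 1 ≤ d)
    {Z : Subscheme (Exponents n d)} (hX : Z.IsIn (veronese n d)) (hr : Z.IsReduced)
    (hs : Z.HasLength s) {f : PSpace (Exponents n d)} (hf : f ∈ Z.linSpan) :
    ∃ T : Finset (PSpace (Exponents n d)), (T : Set _) = Z.support ∧ T.card ≤ s ∧
      (T : Set _) ⊆ veronese n d ∧
      f.rep ∈ Submodule.span ℂ (Projectivization.rep '' (T : Set (PSpace (Exponents n d)))) := by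
  have hfin : Z.support.Finite := by
    by_contra h
    obtain ⟨T, hT, hc⟩ := Set.Infinite.exists_subset_card_eq h (s + 1)
    have := Z.card_le_of_hasLength hs T hT
    omega
  refine ⟨hfin.toFinset, hfin.coe_toFinset, Z.card_le_of_hasLength hs _ (by simp), ?_, ?_⟩
  · intro x hx
    rw [hfin.coe_toFinset] at hx
    exact mem_veronese_of_homIdeal hd x fun p hp => hx p (hX hp)
  · rw [hfin.coe_toFinset]
    exact Z.rep_mem_span_of_isReduced hr hf

/-! ### Tangent vectors of the Veronese variety -/

theorem linForm_add {n : ℕ} {A : Type} [CommRing A] (a b : Fin (n + 1) → A) :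
    linForm (a + b) = linForm a + linForm b := by
  simp [linForm, add_mul, Finset.sum_add_distrib]

theorem linForm_smul {n : ℕ} {A : Type} [CommRing A] (c : A) (a : Fin (n + 1) → A) :
    linForm (c • a) = C c * linForm a := by
  simp [linForm, Finset.mul_sum, mul_assoc]

theorem isHomogeneous_linForm {n : ℕ} {A : Type} [CommRing A] (a : Fin (n + 1) → A) :
    (linForm a).IsHomogeneous 1 :=
  IsHomogeneous.sum _ _ _ fun _ _ => isHomogeneous_C_mul_X _ _

/-- The coefficients of the product of the `(d - 1)`-st power of the linear form with coefficients
`a` and the linear form with coefficients `b`. -/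
noncomputable def tangentVec (n d : ℕ) (a b : Fin (n + 1) → ℂ) : Exponents n d → ℂ :=
  fun m => coeff m.1 (linForm a ^ (d - 1) * linForm b)

theorem tangentVec_add {n d : ℕ} (a b b' : Fin (n + 1) → ℂ) :
    tangentVec n d a (b + b') = tangentVec n d a b + tangentVec n d a b' := by
  funext m
  simp [tangentVec, linForm_add, mul_add]

theorem tangentVec_smul {n d : ℕ} (a : Fin (n + 1) → ℂ) (c : ℂ) (b : Fin (n + 1) → ℂ) :
    tangentVec n d a (c • b) = c • tangentVec n d a b := by
  funext m
  simp only [tangentVec, linForm_smul, mul_left_comm _ (C c), coeff_C_mul, Pi.smul_apply,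
    smul_eq_mul]

theorem tangentVec_self {n d : ℕ} (hd : 1 ≤ d) (a : Fin (n + 1) → ℂ) :
    tangentVec n d a a = powerVec n d a := by
  funext m
  rw [tangentVec, ← pow_succ, Nat.sub_add_cancel hd, powerVec_eq_coeff]

theorem add_pow_of_sq_eq_zero {R : Type} [CommRing R] (x : R) {y : R} (hy : y * y = 0) (k : ℕ) :
    (x + y) ^ (k + 1) = x ^ (k + 1) + (k + 1) * x ^ k * y := by
  induction k with
  | zero => simp
  | succ k ih =>
    rw [pow_succ, ih]
    push_cast
    linear_combination ((k : R) + 1) * x ^ k * hy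

/-- This is `(L + ε M) ^ (k + 1) = L ^ (k + 1) + ε (k + 1) L ^ k M`, read off coefficientwise. -/
theorem coeff_linForm_dualNumber_pow {n k : ℕ} (y : Fin (n + 1) → DualNumber ℂ)
    (m : Fin (n + 1) →₀ ℕ) :
    coeff m (linForm y ^ (k + 1)) =
      TrivSqZeroExt.inl (coeff m (linForm (fun j => (y j).fst) ^ (k + 1))) +
      TrivSqZeroExt.inr ((k + 1) * coeff m (linForm (fun j => (y j).fst) ^ k *
        linForm fun j => (y j).snd)) := by
  let ι : ℂ →+* DualNumber ℂ := TrivSqZeroExt.inlHom ℂ ℂ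
  have h : linForm y = map ι (linForm fun j => (y j).fst) +
      C DualNumber.eps * map ι (linForm fun j => (y j).snd) := by
    simp only [linForm, map_sum, map_mul, map_C, map_X, Finset.mul_sum, ← Finset.sum_add_distrib]
    refine Finset.sum_congr rfl fun j _ => ?_
    rw [← mul_assoc, ← C_mul, ← add_mul, ← C_add]
    congr 2
    ext <;> simp [ι]
  have h0 (r : MvPolynomial (Fin (n + 1)) (DualNumber ℂ)) :
      C DualNumber.eps * r * (C DualNumber.eps * r) = 0 := by
    rw [mul_mul_mul_comm, ← C_mul, DualNumber.eps_mul_eps, C_0, zero_mul]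
  have h1 : linForm y ^ (k + 1) = map ι (linForm (fun j => (y j).fst) ^ (k + 1)) +
      C (DualNumber.eps * ι (k + 1)) *
        map ι (linForm (fun j => (y j).fst) ^ k * linForm fun j => (y j).snd) := by
    rw [h, add_pow_of_sq_eq_zero _ (h0 _)]
    simp only [map_mul, map_pow, map_add, map_natCast, map_one]
    ring
  rw [h1, coeff_add, coeff_C_mul, coeff_map, coeff_map]
  ext
  · simp [ι]
  · simp [ι, add_mul]

theorem fst_aeval {σ : Type} (z : σ → DualNumber ℂ) (q : MvPolynomial σ ℂ) :
    (aeval z q).fst = eval (fun i => (z i).fst) q := by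
  have := DFunLike.congr_fun (comp_aeval z (TrivSqZeroExt.fstHom ℂ ℂ ℂ)) q
  exact this

theorem snd_aeval_linear {σ : Type} (z : σ → DualNumber ℂ) {p : MvPolynomial σ ℂ}
    (hp : p.IsHomogeneous 1) : (aeval z p).snd = eval (fun i => (z i).snd) p := by
  have h : p ∈ Submodule.span ℂ (Set.range (X : σ → MvPolynomial σ ℂ)) := by
    rw [← homogeneousSubmodule_one_eq_span_X]
    exact hp
  clear hp
  induction h using Submodule.span_induction with
  | mem p h =>
    obtain ⟨i, rfl⟩ := h
    simp
  | zero => simp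
  | add p q _ _ hp' hq' => rw [map_add, map_add, TrivSqZeroExt.snd_add, hp', hq']
  | smul c p _ hp' => rw [map_smul, smul_eval, TrivSqZeroExt.snd_smul, hp', smul_eq_mul]

/-- The points in the span of a scheme of length two in the Veronese variety which is non-reduced
at the power of a linear form are multiples of the next lower power of that form. -/
theorem Subscheme.exists_rep_eq_tangentVec {n d : ℕ} (hd : 1 ≤ d) {Z : Subscheme (Exponents n d)}
    (hX : Z.IsIn (veronese n d)) (hZ : Z.HasLength 2) {x f : PSpace (Exponents n d)}
    (hx : Z.IsNonReducedAt x) (hxX : x ∈ veronese n d) (hf : f ∈ Z.linSpan) :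
    ∃ a b : Fin (n + 1) → ℂ, a ≠ 0 ∧ x.rep = powerVec n d a ∧ f.rep = tangentVec n d a b := by
  obtain ⟨a, ha, hxa⟩ := exists_eq_powerVec hd x.rep_nonzero (by rwa [x.mk_rep])
  obtain ⟨z, hz1, hzI, hzL⟩ := exists_dualNumber_of_isNonReducedAt hZ hx
  have hz1' : (fun i => (z i).fst) = powerVec n d a := by rw [← hxa]; exact funext hz1
  obtain ⟨i, hi⟩ := Function.ne_iff.1 ha
  have hspan : f.rep ∈ Submodule.span ℂ {powerVec n d a, fun i => (z i).snd} := by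
    refine mem_span_of_forall_linear fun p hp hv => hf p (hzL p hp ?_) hp
    refine TrivSqZeroExt.ext ?_ ?_
    · rw [fst_aeval, hz1']
      exact hv _ (by simp)
    · rw [snd_aeval_linear z hp]
      exact hv _ (by simp)
  have hm := mul_pow_eq_coeff_of_veroneseEq hd z i fun m =>
    hzI d _ (hX (veroneseEq_mem hd i m)) (isHomogeneous_veroneseEq hd i m)
  have hY (j : Fin (n + 1)) :
      (aeval z (normCoord (mixedExp hd i j))).fst = a i ^ (d - 1) * a j := by
    rw [fst_aeval, hz1', eval_normCoord_powerVec, prod_pow_mixedExp]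
  obtain ⟨κ, hκ⟩ : ∃ κ, aeval z (normCoord (mixedExp hd i i)) ^ (d - 1) * κ = 1 := by
    refine IsUnit.exists_right_inv (IsUnit.pow _ ?_)
    rw [TrivSqZeroExt.isUnit_iff_isUnit_fst, hY, isUnit_iff_ne_zero]
    exact mul_ne_zero (pow_ne_zero _ hi) hi
  obtain ⟨k, rfl⟩ : ∃ k, d = k + 1 := ⟨d - 1, by omega⟩
  set β := fun j => (aeval z (normCoord (mixedExp hd i j))).snd
  set c := a i ^ (k + 1 - 1)
  have hα : (fun j => (aeval z (normCoord (mixedExp hd i j))).fst) = c • a := funext hY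
  obtain ⟨b, hv⟩ : ∃ b, (fun m => (z m).snd) = tangentVec n (k + 1) a b := by
    -- The equations give `z = κ * (c * a + ε β) ^ (k + 1)` with `κ` a unit; this witness collects
    -- the `ε`-part, whose terms are all divisible by `a ^ k`.
    refine ⟨(κ.fst * (k + 1) * c ^ k) • β + (κ.snd * c ^ (k + 1)) • a, ?_⟩
    funext m
    have h1 : z m = κ * coeff m.1
        (linForm (fun j => aeval z (normCoord (mixedExp hd i j))) ^ (k + 1)) := by
      rw [← hm m]
      linear_combination -z m * hκ
    rw [h1, coeff_linForm_dualNumber_pow, hα, linForm_smul, mul_pow, mul_pow, ← C_pow, ← C_pow,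
      coeff_C_mul, mul_assoc, coeff_C_mul, tangentVec_add, tangentVec_smul, tangentVec_smul,
      tangentVec_self hd]
    simp [powerVec_eq_coeff, tangentVec, β]
    ring
  rw [Submodule.mem_span_pair, hv, ← tangentVec_self hd a] at hspan
  obtain ⟨r, s, hrs⟩ := hspan
  refine ⟨a, r • a + s • b, ha, hxa, ?_⟩
  rw [tangentVec_add, tangentVec_smul, tangentVec_smul, hrs]

/-! ### Linear changes of variables -/

theorem aeval_linForm {n : ℕ} (φ : (Fin (n + 1) → ℂ) →ₗ[ℂ] (Fin (n + 1) → ℂ))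
    (a : Fin (n + 1) → ℂ) :
    aeval (fun j => linForm (φ (Pi.single j 1))) (linForm a) = linForm (φ a) := by
  have h : φ a = ∑ j, a j • φ (Pi.single j 1) := by
    conv_lhs => rw [pi_eq_sum_univ' a]
    simp
  simp only [linForm, map_sum, map_mul, aeval_X, algHom_C, algebraMap_eq, h, Finset.sum_apply,
    Pi.smul_apply, smul_eq_mul, Finset.mul_sum, Finset.sum_mul, mul_assoc]
  rw [Finset.sum_comm]

theorem sum_monomial_coeff {n d : ℕ} {p : MvPolynomial (Fin (n + 1)) ℂ} (hp : p.IsHomogeneous d) :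
    ∑ m : Exponents n d, monomial m.1 (coeff m.1 p) = p := by
  rw [Finset.sum_coe_sort (Finset.finsuppAntidiag (Finset.univ : Finset (Fin (n + 1))) d)
    fun m => monomial m (coeff m p)]
  conv_rhs => rw [p.as_sum]
  refine (Finset.sum_subset (fun m hm => ?_) fun m _ hm => ?_).symm
  · rw [Finset.mem_finsuppAntidiag]
    refine ⟨?_, Finset.subset_univ _⟩
    rw [hp.degree_eq_sum_deg_support hm]
    exact (Finset.sum_subset (Finset.subset_univ _) (by simp)).symm
  · rw [notMem_support_iff.1 hm, map_zero]

/-- A linear substitution of the variables, as an action on the coefficients of forms. -/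
theorem exists_linearMap_of_substitution {n d : ℕ} (hd : 1 ≤ d)
    (φ : (Fin (n + 1) → ℂ) →ₗ[ℂ] (Fin (n + 1) → ℂ)) :
    ∃ Φ : (Exponents n d → ℂ) →ₗ[ℂ] (Exponents n d → ℂ), ∀ a b,
      Φ (tangentVec n d a b) = tangentVec n d (φ a) (φ b) := by
  let S : MvPolynomial (Fin (n + 1)) ℂ →ₐ[ℂ] MvPolynomial (Fin (n + 1)) ℂ :=
    aeval fun j => linForm (φ (Pi.single j 1))
  refine ⟨LinearMap.pi fun m => lcoeff ℂ m.1 ∘ₗ S.toLinearMap ∘ₗ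
    ∑ k : Exponents n d, monomial k.1 ∘ₗ LinearMap.proj k, fun a b => ?_⟩
  funext m
  have hh : (linForm a ^ (d - 1) * linForm b).IsHomogeneous d := by
    have := ((isHomogeneous_linForm a).pow (d - 1)).mul (isHomogeneous_linForm b)
    rwa [one_mul, Nat.sub_add_cancel hd] at this
  have h := sum_monomial_coeff hh
  simp only [LinearMap.pi_apply, LinearMap.comp_apply, LinearMap.sum_apply, LinearMap.proj_apply,
    tangentVec, h]
  simp only [AlgHom.toLinearMap_apply, lcoeff_apply, S, map_mul, map_pow, aeval_linForm]

/-- Take a functional `θ` vanishing at `a` but not at `b`, and add a multiple of `θ(·) a` to the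
identity. Then `θ ∘ φ = θ`, which gives injectivity. -/
theorem exists_transvection {V : Type} [AddCommGroup V] [Module ℂ V] {a b : V}
    (h : b ∉ Submodule.span ℂ {a}) (c : ℂ) :
    ∃ φ : V →ₗ[ℂ] V, φ a = a ∧ φ b = b + c • a ∧ ∀ w, φ w = 0 → w = 0 := by
  obtain ⟨θ, hθ, hle⟩ := Submodule.exists_le_ker_of_notMem h
  have hθa : θ a = 0 := hle (Submodule.mem_span_singleton_self a)
  refine ⟨LinearMap.id + (c / θ b) • θ.smulRight a, by simp [hθa], by simp [smul_smul, hθ],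
    fun w hw => ?_⟩
  have hθw : θ w = 0 := by simpa [hθa] using congrArg θ hw
  simpa [hθw] using hw

end ProjGeom

open ProjGeom

/-! ### The rank contradiction -/

theorem mainTheorem10 (n d : ℕ) (hd : 1 ≤ d)
    (f : ProjGeom.PSpace (ProjGeom.Exponents n d))
    (hf : f ∈ ProjGeom.tangentialVariety (ProjGeom.veronese n d) \ ProjGeom.veronese n d) :
    ProjGeom.ranestadSchreyerLocus (ProjGeom.veronese n d) f 2 ⊆
      ProjGeom.forbiddenLocus (ProjGeom.veronese n d) f := by
  classical
  rintro x ⟨hxX, Y, hYX, hY2, hfY, hYx⟩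
  refine ⟨hxX, ?_⟩
  rintro ⟨Z, hZX, hZr, hZs, hfZ, hxZ⟩
  obtain ⟨a, b, ha, hxa, hfab⟩ := Subscheme.exists_rep_eq_tangentVec hd hYX hY2 hYx hxX hfY
  obtain ⟨T, hTZ, hTs, hTX, hfT⟩ := Subscheme.exists_finset_of_isReduced hd hZX hZr hZs hfZ
  have hxT : x ∈ T := by
    rw [← Finset.mem_coe, hTZ]
    exact hxZ
  have hb : b ∉ Submodule.span ℂ {a} := by
    intro hb
    obtain ⟨c, rfl⟩ := Submodule.mem_span_singleton.1 hb
    rw [tangentVec_smul, tangentVec_self hd] at hfab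
    exact hf.2 ⟨a, ha, f.mk_rep.symm.trans
      ((Projectivization.mk_eq_mk_iff' ℂ _ _ _ _).2 ⟨c, hfab.symm⟩)⟩
  rw [← Finset.insert_erase hxT, Finset.coe_insert, Set.image_insert_eq,
    Submodule.mem_span_insert] at hfT
  obtain ⟨c, w, hw, hfw⟩ := hfT
  obtain ⟨φ, hφa, hφb, hφ⟩ := exists_transvection hb c
  obtain ⟨Φ, hΦ⟩ := exists_linearMap_of_substitution hd φ
  have hΦw : Φ w = f.rep := by
    have hw' : w = tangentVec n d a (b + (-c) • a) := by
      rw [tangentVec_add, tangentVec_smul, ← hfab, tangentVec_self hd, ← hxa, hfw]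
      module
    rw [hw', hΦ, map_add, map_smul, hφa, hφb, hfab]
    congr 1
    module
  -- Injectivity of `φ` keeps the linear forms nonzero, so `Φ` sends points of the variety to points
  -- of it. The value `x` off the variety is a dummy that makes `F` total.
  have himg (y : PSpace (Exponents n d)) : ∃ y' ∈ veronese n d,
      y ∈ veronese n d → Φ y.rep ∈ y'.submodule := by
    by_cases hy : y ∈ veronese n d
    · obtain ⟨e, he, hye⟩ := exists_eq_powerVec hd y.rep_nonzero (by rwa [y.mk_rep])
      have hφe : φ e ≠ 0 := fun h => he (hφ e h)
      refine ⟨_, ⟨φ e, hφe, rfl⟩, fun _ => ?_⟩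
      rw [Projectivization.submodule_mk, hye, ← tangentVec_self hd, ← tangentVec_self hd, hΦ]
      exact Submodule.mem_span_singleton_self _
    · exact ⟨x, hxX, fun h => absurd h hy⟩
  choose F hFX hF using himg
  have hle : xRank (veronese n d) f ≤ ((T.erase x).image F).card := by
    refine Nat.sInf_le ⟨_, ?_, rfl, ?_⟩
    · intro y hy
      obtain ⟨y', -, rfl⟩ := Finset.mem_image.1 (Finset.mem_coe.1 hy)
      exact hFX y'
    · rw [submodule_le_iff, ← hΦw]
      refine Submodule.mem_comap.1 (Submodule.span_le.2 ?_ hw)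
      rintro _ ⟨y, hy, rfl⟩
      have hmem : F y ∈ (T.erase x).image F := Finset.mem_image_of_mem F hy
      exact (le_iSup₂_of_le (F y) hmem le_rfl : (F y).submodule ≤ _)
        (hF y (hTX (Finset.mem_of_mem_erase hy)))
  -- The rank is at most `T.card - 1`, while `T.card` is positive and at most the rank.
  have h1 := (hle.trans Finset.card_image_le).trans_eq (Finset.card_erase_of_mem hxT)
  have h2 := Finset.card_pos.2 ⟨x, hxT⟩
  omega
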